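/- \textbf{Setting.} Let $\mathbb F$ be a field of characteristic $0$, $\sigma_y$ the automorphism $r(y)\mapsto r(y+1)$ of $\mathbb F(y)$, and $\mathbb D$ a ring containing $\mathbb F(y)$ with an endomorphism $\sigma_y$ extending this automorphism; put $\Delta_y=\sigma_y-1$. A nonzero $T\in\mathbb D$ is a \emph{hypergeometric term} if $\sigma_y(T)=RT$ for some $R\in\mathbb F(y)$ (its \emph{shift quotient}); it is \emph{irrational} if it is not of the form $Rc$ with $R\in\mathbb F(y)$ and $c\in\mathbb D$, $\sigma_y(c)=c$; it is \emph{summable} if $T=\Delta_y(G)$ for some hypergeometric term $G\in\mathbb D$. A nonzero polynomial is \emph{shift-free} if it is coprime with $\sigma_y^i$ of itself for all integers $i\ne0$; a nonzero rational function is \emph{shift-reduced} if its numerator is coprime with all integer shifts of its denominator. A \emph{multiplicative decomposition} of $T$ is $T=SH$ with $S\in\mathbb F(y)$ (the \emph{shell}) and $H$ a hypergeometric term whose shift quotient $K$ (the \emph{kernel}) is shift-reduced; write $K=u/v$ with coprime $u,v\in\mathbb F[y]$. A nonzero polynomial $p$ is \emph{strongly prime with $K$} if $\gcd(p,\sigma_y^{-i}(u))=\gcd(p,\sigma_y^{i}(v))=1$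 for all $i\ge0$. Let $\phi_K:\mathbb F[y]\to\mathbb F[y]$, $\phi_K(p)=u\,\sigma_y(p)-v\,p$, and let the standard complement $\mathbb W_K$ of $\mathrm{im}(\phi_K)$ be the $\mathbb F$-span of all $y^\ell$ ($\ell\ge0$) such that $\ell$ is not the degree of any nonzero element of $\mathrm{im}(\phi_K)$. A rational function $r$ is a \emph{residual form} of $S$ w.r.t. $K$ if $S-r=K\sigma_y(w)-w$ for some $w\in\mathbb F(y)$, and $r=a/b+q/v$ with $a,b,q\in\mathbb F[y]$, $\deg a<\deg b$, $b$ shift-free and strongly prime with $K$, and $q\in\mathbb W_K$. \textbf{Modified Abramov--Petkov\v{s}ek reduction.} Input: an irrational hypergeometric term $T$. \begin{enumerate} \item Find a multiplicative decomposition $T=SH$ with kernel $K=u/v$. \item (Shell reduction.) Apply the Abramov--Petkov\v{s}ek reduction to find $S_1\in\mathbb F(y)$ and $b,w\in\mathbb F[y]$, with $b$ shift-free and strongly prime with $K$, such that $S=K\sigma_y(S_1)-S_1+\frac{w}{b\,\sigma_y^{-1}(u)\,v}$. Write the last summand as $\frac sb+\frac{p_1}{\sigma_y^{-1}(u)}+\frac{p_2}v$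 with $s,p_1,p_2\in\mathbb F[y]$, and set $g=S_1-\frac{p_1}{\sigma_y^{-1}(u)}$, $t=\sigma_y(p_1)+p_2$. \item Let $p$ and $a$ be the quotient and the remainder of $s$ by $b$. \item (Polynomial reduction.) Take $P_0,P_1,\dots\in\mathbb F[y]$ such that the $\phi_K(P_i)$ form an $\mathbb F$-basis of $\mathrm{im}(\phi_K)$ of strictly increasing degrees. If $vp+t=0$, set $h=q=0$. Otherwise find a linear combination $h$ of those $P_i$ with $\deg\phi_K(P_i)\le\deg(vp+t)$ such that $q=vp+t-\phi_K(h)$ lies in $\mathbb W_K$. \item Return $H$, $f=g+h$ and $r=a/b+q/v$. \end{enumerate} \textbf{Theorem.} Let $T$ be an irrational hypergeometric term. If $\sigma_y(T)\neq0$, then Step 1 can be carried out. For every multiplicative decomposition $T=SH$ with kernel $K=u/v$, Steps 2--5 can always be carried out, whatever choices are made in the earlier steps, and every resulting output $f,r\in\mathbb F(y)$ satisfies: $r$ is a residual form of $S$ w.r.t. $K$, $$T=\Delta_y(fH)+rH,$$ and $T$ is summable if and only if $r=0$. -/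

import Mathlib

open Polynomial

namespace HypergeometricReduction

noncomputable section

variable {F : Type*} [Field F]

/-! ### Shifts of polynomials and rational functions -/

/-- The `i`-th power of the shift on `F[y]`, `p(y) ↦ p(y + i)`, for an integer `i`. -/
def shiftPoly (i : ℤ) (p : F[X]) : F[X] := taylor (i : F) p

/-- The automorphism `σ_y` of `F(y)`, `r(y) ↦ r(y + 1)`. -/
def shift : RatFunc F ≃+* RatFunc F :=
  IsFractionRing.ringEquivOfRingEquiv (taylorEquiv (1 : F)).toRingEquiv

/-- `shift` extends the shift of polynomials. -/
theorem shift_algebraMap (p : F[X]) :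
    shift (algebraMap F[X] (RatFunc F) p) = algebraMap F[X] (RatFunc F) (shiftPoly 1 p) := by
  rw [shift, IsFractionRing.ringEquivOfRingEquiv_algebraMap]
  simp only [shiftPoly, Int.cast_one]
  rfl

/-- The fraction `p / q` in `F(y)` of two polynomials. -/
def frac (p q : F[X]) : RatFunc F :=
  algebraMap F[X] (RatFunc F) p / algebraMap F[X] (RatFunc F) q

/-- A nonzero polynomial that is coprime with all its nontrivial shifts. -/
def IsShiftFree (p : F[X]) : Prop :=
  p ≠ 0 ∧ ∀ i : ℤ, i ≠ 0 → IsCoprime p (shiftPoly i p)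

/-- A nonzero rational function whose numerator is coprime with all shifts of its denominator. -/
def IsShiftReduced (f : RatFunc F) : Prop :=
  f ≠ 0 ∧ ∀ i : ℤ, IsCoprime f.num (shiftPoly i f.denom)

/-- `p` is strongly prime with `K = u / v`: it is nonzero and
`gcd (p, σ_y^{-i} u) = gcd (p, σ_y^i v) = 1` for all `i ≥ 0`. -/
def IsStronglyPrime (u v p : F[X]) : Prop :=
  p ≠ 0 ∧ ∀ i : ℕ, IsCoprime p (shiftPoly (-(i : ℤ)) u) ∧ IsCoprime p (shiftPoly (i : ℤ) v)

/-! ### Hypergeometric terms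

A difference ring extension of `F(y)` is given by a ring `D`, the inclusion `ι : F(y) → D` and an
endomorphism `σ` of `D` that agrees with `shift` on `F(y)`. -/

section Terms

variable {D : Type*} [Ring D]

/-- `T` is a nonzero element of `D` with `σ T = R T` for some `R` in `F(y)`. -/
def IsHypergeometric (ι : RatFunc F →+* D) (σ : D →+* D) (T : D) : Prop :=
  T ≠ 0 ∧ ∃ R : RatFunc F, σ T = ι R * T

/-- `T` is the product of a rational function and a constant of `D`. -/
def IsRationalTerm (ι : RatFunc F →+* D) (σ : D →+* D) (T : D) : Prop :=
  ∃ (R : RatFunc F) (c : D), σ c = c ∧ T = ι R * c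

/-- `T` is the difference of a hypergeometric term. -/
def IsSummable (ι : RatFunc F →+* D) (σ : D →+* D) (T : D) : Prop :=
  ∃ G : D, IsHypergeometric ι σ G ∧ T = σ G - G

/-- `T = S H` is a multiplicative decomposition with shell `S` and kernel `K = u / v`: `H` is a
hypergeometric term whose shift quotient `K` is shift-reduced, and `u`, `v` are coprime. -/
structure IsMultDecomp (ι : RatFunc F →+* D) (σ : D →+* D) (T : D)
    (S : RatFunc F) (H : D) (K : RatFunc F) (u v : F[X]) : Prop where
  eq_mul : T = ι S * H
  ne_zero : H ≠ 0
  quotient : σ H = ι K * H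
  shiftReduced : IsShiftReduced K
  coprime : IsCoprime u v
  denom_ne_zero : v ≠ 0
  kernel_eq : K = frac u v

end Terms

/-! ### The map for polynomial reduction and residual forms -/

/-- The map `φ_K : p ↦ u σ_y(p) - v p` on `F[y]`, where `K = u / v`. -/
def phi (u v : F[X]) : F[X] →ₗ[F] F[X] :=
  LinearMap.mulLeft F u ∘ₗ taylor (1 : F) - LinearMap.mulLeft F v

theorem phi_apply (u v p : F[X]) : phi u v p = u * shiftPoly 1 p - v * p := by
  simp [phi, shiftPoly]

/-- The standard complement `W_K` of the image of `φ_K`: the span of all powers `y ^ l` such that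
`l` is not the degree of any (nonzero) polynomial in the image. -/
def standardComplement (u v : F[X]) : Submodule F F[X] :=
  Submodule.span F {m | ∃ l : ℕ, (∀ p ∈ LinearMap.range (phi u v), p.degree ≠ (l : WithBot ℕ)) ∧
    m = X ^ l}

/-- `f ≡ g` modulo `V_K = {K σ_y(w) - w | w ∈ F(y)}`. -/
def Congr (K f g : RatFunc F) : Prop :=
  ∃ w : RatFunc F, f - g = K * shift w - w

/-- `r` is a (discrete) residual form of `f` with respect to `K = u / v`. -/
def IsResidualForm (K : RatFunc F) (u v : F[X]) (f r : RatFunc F) : Prop :=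
  Congr K f r ∧ ∃ a b q : F[X], r = frac a b + frac q v ∧ a.degree < b.degree ∧
    IsShiftFree b ∧ IsStronglyPrime u v b ∧ q ∈ standardComplement u v

/-! ### The subroutines of the modified reduction -/

/-- Input-output relation of the Abramov–Petkovšek reduction: from the shell `S` and the kernel
`K = u / v` it computes `S₁`, `b`, `w`. -/
def IsAPReduction (K : RatFunc F) (u v : F[X]) (S : RatFunc F)
    (S₁ : RatFunc F) (b w : F[X]) : Prop :=
  IsShiftFree b ∧ IsStronglyPrime u v b ∧
    S = K * shift S₁ - S₁ + frac w (b * shiftPoly (-1) u * v)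

/-- Shell reduction: apply the Abramov–Petkovšek reduction, decompose the last summand of its result
as `s / b + p₁ / σ_y⁻¹(u) + p₂ / v`, and move the middle summand into the difference part. The output
is `g`, `s`, `b`, `t`. -/
def IsShellReduction (K : RatFunc F) (u v : F[X]) (S : RatFunc F)
    (g : RatFunc F) (s b t : F[X]) : Prop :=
  ∃ (S₁ : RatFunc F) (w p₁ p₂ : F[X]),
    IsAPReduction K u v S S₁ b w ∧
    frac w (b * shiftPoly (-1) u * v) = frac s b + frac p₁ (shiftPoly (-1) u) + frac p₂ v ∧
    g = S₁ - frac p₁ (shiftPoly (-1) u) ∧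
    t = shiftPoly 1 p₁ + p₂

/-- `P 0, P 1, …` are polynomials whose images under `φ_K` form an echelon basis of the image of
`φ_K`, sorted by increasing degree. -/
def IsEchelonSequence (u v : F[X]) (P : ℕ → F[X]) : Prop :=
  (∀ i, phi u v (P i) ≠ 0) ∧
  (∀ i, (phi u v (P i)).degree < (phi u v (P (i + 1))).degree) ∧
  Submodule.span F (Set.range fun i => phi u v (P i)) = LinearMap.range (phi u v)

/-- Polynomial reduction of `p` with the echelon basis given by `P`. If `p = 0`, return `(0, 0)`.
Otherwise let `φ_K(P 0), …, φ_K(P (n - 1))` be the basis elements of degree at most `deg p`,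
eliminate so that the remainder `q = p - φ_K(h)` with `h = ∑ c i • P i` lies in `W_K`, and
return `(h, q)`. -/
def IsPolynomialReduction (u v : F[X]) (P : ℕ → F[X]) (p h q : F[X]) : Prop :=
  (p = 0 ∧ h = 0 ∧ q = 0) ∨
  (p ≠ 0 ∧ ∃ (n : ℕ) (c : ℕ → F),
    (∀ i, i < n ↔ (phi u v (P i)).degree ≤ p.degree) ∧
    h = ∑ i ∈ Finset.range n, c i • P i ∧
    q = p - phi u v h ∧
    q ∈ standardComplement u v)

end

end HypergeometricReduction

namespace HypergeometricReduction

noncomputable section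

variable {F : Type*} [Field F]

/-! ### Shifts of polynomials -/

section Shifts

/-! Since `Δ(w H) = (K σ(w) - w) H` for rational `w`, and `H` can be cancelled, everything about `T
= S H` becomes a statement about `S` modulo `V_K = {K σ(w) - w}`; in particular `T` is summable iff
`S ∈ V_K` (`IsMultDecomp.isSummable_iff`). The identity `S - r = K σ(f) - f`
(`IsShellReduction.eq_add`) gives the decomposition of `T`, and the criterion `r = 0` follows
because `V_K` contains no nonzero residual form (`residualForm_eq_zero_of_difference_eq`). There, a
pole of `w` leaves poles of `K σ(w) - w` at both ends of its shift orbit, which a shift-free `b`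
strongly prime with `K` cannot absorb; so `w` is a polynomial, and degree considerations finish.

It remains to see that no step gets stuck. Kernels come from splitting off factors `σ(S) / S`
(`exists_isShiftReduced_mul`). In the shell, each prime power of the denominator is carried along
its orbit to a strongly prime representative, the same for the whole orbit
(`exists_reducesTo_add_frac`). In the polynomial part, irrationality makes `φ_K` injective, so its
image has infinitely many degrees and an infinite echelon basis; the remaining degrees are those of
the monomials spanning `W_K`. -/

@[simp]
theorem shiftPoly_zero (p : F[X]) : shiftPoly 0 p = p := by
  simp [shiftPoly]

theorem shiftPoly_shiftPoly (i j : ℤ) (p : F[X]) :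
    shiftPoly i (shiftPoly j p) = shiftPoly (i + j) p := by
  simp [shiftPoly, taylor_taylor]

theorem shiftPoly_mul (i : ℤ) (p q : F[X]) :
    shiftPoly i (p * q) = shiftPoly i p * shiftPoly i q :=
  taylor_mul _ p q

theorem shiftPoly_pow (i : ℤ) (p : F[X]) (n : ℕ) : shiftPoly i (p ^ n) = shiftPoly i p ^ n :=
  taylor_pow (r := (i : F)) (f := p) n

@[simp]
theorem shiftPoly_one (i : ℤ) : shiftPoly i (1 : F[X]) = 1 := by
  simp [shiftPoly, taylor_one]

@[simp]
theorem shiftPoly_eq_zero {i : ℤ} {p : F[X]} : shiftPoly i p = 0 ↔ p = 0 :=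
  taylor_eq_zero _ _

theorem shiftPoly_ne_zero {p : F[X]} (i : ℤ) (hp : p ≠ 0) : shiftPoly i p ≠ 0 :=
  fun h => hp (shiftPoly_eq_zero.1 h)

@[simp]
theorem natDegree_shiftPoly (i : ℤ) (p : F[X]) : (shiftPoly i p).natDegree = p.natDegree :=
  natDegree_taylor p _

theorem shiftPoly_dvd_shiftPoly (i : ℤ) {p q : F[X]} (h : p ∣ q) :
    shiftPoly i p ∣ shiftPoly i q := by
  obtain ⟨c, rfl⟩ := h
  exact ⟨shiftPoly i c, shiftPoly_mul i p c⟩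

theorem isCoprime_shiftPoly_shiftPoly (i : ℤ) {p q : F[X]} (h : IsCoprime p q) :
    IsCoprime (shiftPoly i p) (shiftPoly i q) :=
  h.map (taylorAlgHom (i : F)).toRingHom

theorem isCoprime_shiftPoly_iff (i j : ℤ) (p q : F[X]) :
    IsCoprime (shiftPoly i p) (shiftPoly j q) ↔ IsCoprime p (shiftPoly (j - i) q) := by
  constructor
  · intro h
    have := isCoprime_shiftPoly_shiftPoly (-i) h
    rw [shiftPoly_shiftPoly, shiftPoly_shiftPoly] at this
    simpa [show -i + j = j - i by ring] using this
  · intro h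
    have := isCoprime_shiftPoly_shiftPoly i h
    rwa [shiftPoly_shiftPoly, add_sub_cancel] at this

theorem irreducible_shiftPoly (i : ℤ) {p : F[X]} (hp : Irreducible p) :
    Irreducible (shiftPoly i p) :=
  (MulEquiv.irreducible_iff (taylorEquiv (i : F))).2 hp

theorem aeval_shiftPoly {A : Type*} [CommRing A] [Algebra F A] (i : ℤ) (p : F[X]) (z : A) :
    aeval z (shiftPoly i p) = aeval (z + (i : A)) p := by
  simp [shiftPoly, taylor_apply, aeval_comp]

theorem not_aeval_eq_zero_of_isCoprime {A : Type*} [CommRing A] [Nontrivial A] [Algebra F A]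
    {p q : F[X]} (h : IsCoprime p q) {z : A} (hp : aeval z p = 0) : aeval z q ≠ 0 :=
  (aeval_ne_zero_of_isCoprime h z).resolve_left (not_not.2 hp)

theorem exists_aeval_eq_zero_of_irreducible {p : F[X]} (hp : Irreducible p) :
    ∃ z : AlgebraicClosure F, aeval z p = 0 :=
  IsAlgClosed.exists_aeval_eq_zero _ _ (degree_pos_of_irreducible hp).ne'

/-- In characteristic zero only finitely many integer translates of a point are roots of a given
nonzero polynomial. -/
theorem finite_setOf_aeval_add_intCast [CharZero F] {p : F[X]} (hp : p ≠ 0)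
    (z : AlgebraicClosure F) : {i : ℤ | aeval (z + (i : AlgebraicClosure F)) p = 0}.Finite := by
  have : CharZero (AlgebraicClosure F) := charZero_of_injective_algebraMap
    (algebraMap F (AlgebraicClosure F)).injective
  refine Set.Finite.of_finite_image (f := fun i : ℤ => z + (i : AlgebraicClosure F))
    ((p.rootSet_finite (AlgebraicClosure F)).subset ?_) ?_
  · rintro _ ⟨i, hi, rfl⟩
    exact (mem_rootSet).2 ⟨hp, hi⟩
  · intro i _ j _ hij
    exact Int.cast_injective (add_left_cancel hij)

/-- In characteristic zero an irreducible polynomial is shift-free. -/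
theorem isShiftFree_of_irreducible [CharZero F] {p : F[X]} (hp : Irreducible p) :
    IsShiftFree p := by
  refine ⟨hp.ne_zero, fun i hi => ?_⟩
  by_contra hc
  have hd : p ∣ shiftPoly i p := by
    by_contra hnd
    exact hc ((EuclideanDomain.dvd_or_coprime p _ hp).resolve_left hnd)
  obtain ⟨z, hz⟩ := exists_aeval_eq_zero_of_irreducible hp
  -- As `p` divides its shift by `i`, its roots are stable under translation by `i`, so there would
  -- be infinitely many.
  have key : ∀ n : ℕ, aeval (z + ((n * i : ℤ) : AlgebraicClosure F)) p = 0 := by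
    intro n
    induction n with
    | zero => simpa using hz
    | succ n ih =>
      have := aeval_eq_zero_of_dvd_aeval_eq_zero hd ih
      rw [aeval_shiftPoly] at this
      rw [← this]
      congr 2
      push_cast
      ring
  refine Set.infinite_of_injective_forall_mem (f := fun n : ℕ => (n * i : ℤ)) ?_ key
    (finite_setOf_aeval_add_intCast hp.ne_zero z)
  intro m n h
  have := mul_right_cancel₀ hi h
  exact_mod_cast this

end Shifts

/-! ### Fractions -/

section Fractions

theorem algebraMap_ratFunc_ne_zero {p : F[X]} (hp : p ≠ 0) : algebraMap F[X] (RatFunc F) p ≠ 0 :=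
  RatFunc.algebraMap_ne_zero hp

theorem shift_frac (p q : F[X]) : shift (frac p q) = frac (shiftPoly 1 p) (shiftPoly 1 q) := by
  simp [frac, map_div₀, shift_algebraMap]

theorem shift_ne_zero {x : RatFunc F} (hx : x ≠ 0) : shift x ≠ 0 :=
  (map_ne_zero_iff _ shift.injective).2 hx

theorem frac_num_denom (x : RatFunc F) : frac x.num x.denom = x :=
  RatFunc.num_div_denom x

theorem frac_ne_zero {p q : F[X]} (hp : p ≠ 0) (hq : q ≠ 0) : frac p q ≠ 0 :=
  div_ne_zero (algebraMap_ratFunc_ne_zero hp) (algebraMap_ratFunc_ne_zero hq)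

theorem frac_add_frac_same (p q b : F[X]) : frac p b + frac q b = frac (p + q) b := by
  simp [frac, add_div]

theorem frac_add_frac (p q : F[X]) {b c : F[X]} (hb : b ≠ 0) (hc : c ≠ 0) :
    frac p b + frac q c = frac (p * c + b * q) (b * c) := by
  have := algebraMap_ratFunc_ne_zero hb
  have := algebraMap_ratFunc_ne_zero hc
  simp only [frac, map_add, map_mul]
  exact div_add_div _ _ ‹_› ‹_›

theorem frac_mul_frac (p q b c : F[X]) : frac p b * frac q c = frac (p * q) (b * c) := by
  simp [frac, div_mul_div_comm]

theorem frac_mul_left {b c : F[X]} (p : F[X]) (hc : c ≠ 0) : frac (c * p) (c * b) = frac p b := by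
  have := algebraMap_ratFunc_ne_zero hc
  simp only [frac, map_mul]
  exact mul_div_mul_left _ _ this

theorem frac_eq_frac_iff {p q b c : F[X]} (hb : b ≠ 0) (hc : c ≠ 0) :
    frac p b = frac q c ↔ p * c = q * b := by
  have hb := algebraMap_ratFunc_ne_zero hb
  have hc := algebraMap_ratFunc_ne_zero hc
  rw [frac, frac, div_eq_div_iff hb hc, ← map_mul, ← map_mul,
    (RatFunc.algebraMap_injective F).eq_iff]

/-- A fraction with a product of two coprime polynomials as denominator splits. -/
theorem exists_frac_mul_eq_add {b c : F[X]} (p : F[X]) (hb : b ≠ 0) (hc : c ≠ 0)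
    (h : IsCoprime b c) : ∃ s t : F[X], frac p (b * c) = frac s b + frac t c := by
  obtain ⟨x, y, hxy⟩ := h
  refine ⟨p * y, p * x, ?_⟩
  rw [frac_add_frac _ _ hb hc]
  congr 1
  linear_combination (-p) * hxy

end Fractions

/-! ### Rational normal forms -/

section NormalForms

/-- Coprime representations of `K` differ from `num / denom` by a unit; it suffices that `u ∣ num`
and `v ∣ denom`. -/
theorem IsShiftReduced.isCoprime_shiftPoly {K : RatFunc F} {u v : F[X]} (hK : IsShiftReduced K)
    (huv : IsCoprime u v) (hv : v ≠ 0) (h : K = frac u v) (i : ℤ) :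
    IsCoprime u (shiftPoly i v) := by
  have e : u * K.denom = K.num * v := by
    rw [← frac_eq_frac_iff hv K.denom_ne_zero, frac_num_denom, h]
  have h1 : u ∣ K.num := huv.dvd_of_dvd_mul_right ⟨K.denom, e.symm⟩
  have h2 : v ∣ K.denom := huv.symm.dvd_of_dvd_mul_left ⟨K.num, by rw [e, mul_comm]⟩
  exact (hK.2 i).of_isCoprime_of_dvd_left h1 |>.of_isCoprime_of_dvd_right
    (shiftPoly_dvd_shiftPoly i h2)

/-- The quotient of a polynomial by one of its shifts has the form `S / σ_y(S)`. -/
theorem exists_frac_shiftPoly_eq {p : F[X]} (hp : p ≠ 0) (i : ℤ) :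
    ∃ S : RatFunc F, S ≠ 0 ∧ frac (shiftPoly i p) p = shift S / S := by
  -- The witness telescopes: `p σ(p) ⋯ σ^(i-1)(p)` for `i > 0`, and the inverse of `σ^i(p) ⋯
  -- σ^(-1)(p)` for `i < 0`.
  induction i with
  | zero =>
    exact ⟨1, one_ne_zero, by
      simp [frac, algebraMap_ratFunc_ne_zero hp]⟩
  | succ i ih =>
    obtain ⟨S, hS, h⟩ := ih
    have hq := shiftPoly_ne_zero i hp
    refine ⟨S * frac (shiftPoly i p) 1, mul_ne_zero hS (frac_ne_zero hq one_ne_zero), ?_⟩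
    rw [map_mul, mul_div_mul_comm, ← h, shift_frac, shiftPoly_shiftPoly, add_comm (1 : ℤ)]
    have := algebraMap_ratFunc_ne_zero hq
    have := algebraMap_ratFunc_ne_zero hp
    simp only [frac, shiftPoly_one, map_one]
    field_simp
  | pred i ih =>
    obtain ⟨S, hS, h⟩ := ih
    have hq := shiftPoly_ne_zero (-i - 1) hp
    refine ⟨S / frac (shiftPoly (-i - 1) p) 1, div_ne_zero hS (frac_ne_zero hq one_ne_zero), ?_⟩
    rw [map_div₀, div_div_div_comm, ← h, shift_frac, shiftPoly_shiftPoly,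
      show (1 : ℤ) + (-i - 1) = -i by ring]
    have := algebraMap_ratFunc_ne_zero hq
    have := algebraMap_ratFunc_ne_zero hp
    have := algebraMap_ratFunc_ne_zero (shiftPoly_ne_zero (-(i : ℤ)) hp)
    simp only [frac, shiftPoly_one, map_one]
    field_simp

/-- Every nonzero rational function `R` can be written as `K σ_y(S) / S` with `K` shift-reduced. -/
theorem exists_isShiftReduced_mul (R : RatFunc F) (hR : R ≠ 0) :
    ∃ K S : RatFunc F, IsShiftReduced K ∧ S ≠ 0 ∧ R = K * (shift S / S) := by
  induction hn : R.num.natDegree + R.denom.natDegree using Nat.strong_induction_on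
    generalizing R with
  | _ n ih =>
    by_cases hred : ∀ i : ℤ, IsCoprime R.num (shiftPoly i R.denom)
    · exact ⟨R, 1, ⟨hR, hred⟩, one_ne_zero, by simp⟩
    push Not at hred
    obtain ⟨i, hi⟩ := hred
    have hnum : R.num ≠ 0 := RatFunc.num_ne_zero hR
    have hden := R.denom_ne_zero
    obtain ⟨g, hg, ⟨a, ha⟩, hgd⟩ : ∃ g : F[X], ¬ IsUnit g ∧ g ∣ R.num ∧
        g ∣ shiftPoly i R.denom := by
      by_contra! hno
      refine hi (isCoprime_of_dvd _ _ (fun h => hnum h.1) fun z hz _ hz1 hz2 => hno z hz hz1 hz2)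
    obtain ⟨d, hd⟩ := shiftPoly_dvd_shiftPoly (-i) hgd
    rw [shiftPoly_shiftPoly, neg_add_cancel, shiftPoly_zero] at hd
    have hg0 : g ≠ 0 := by rintro rfl; simp_all
    have ha0 : a ≠ 0 := by rintro rfl; simp_all
    have hd0 : d ≠ 0 := by rintro rfl; simp_all
    have hgs := shiftPoly_ne_zero (-i) hg0
    have hgdeg : 0 < g.natDegree :=
      natDegree_pos_iff_degree_pos.2 (degree_pos_of_ne_zero_of_nonunit hg0 hg)
    -- The second factor has the form `σ(S') / S'`; the first has smaller total degree, since `g` is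
    -- not constant.
    have e : R = frac a d * frac g (shiftPoly (-i) g) := by
      rw [frac_mul_frac, ← frac_num_denom R, ha, hd, mul_comm g, mul_comm d]
    have h1 : R.num.natDegree = g.natDegree + a.natDegree := by rw [ha, natDegree_mul hg0 ha0]
    have h2 : R.denom.natDegree = g.natDegree + d.natDegree := by
      rw [hd, natDegree_mul hgs hd0, natDegree_shiftPoly]
    have h3 : (frac a d).num.natDegree ≤ a.natDegree :=
      natDegree_le_of_dvd ((RatFunc.num_dvd ha0).2 ⟨d, hd0, rfl⟩) ha0
    have h4 : (frac a d).denom.natDegree ≤ d.natDegree :=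
      natDegree_le_of_dvd ((RatFunc.denom_dvd hd0).2 ⟨a, rfl⟩) hd0
    obtain ⟨K, S, hK, hS, hKS⟩ := ih _ (by omega) (frac a d) (frac_ne_zero ha0 hd0) rfl
    obtain ⟨S', hS', hgS⟩ := exists_frac_shiftPoly_eq hgs i
    rw [shiftPoly_shiftPoly, add_neg_cancel, shiftPoly_zero] at hgS
    refine ⟨K, S * S', hK, mul_ne_zero hS hS', ?_⟩
    rw [e, hKS, hgS, map_mul, mul_div_mul_comm, mul_assoc]

end NormalForms

/-! ### The Abramov–Petkovšek reduction -/

section ShellReduction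

theorem IsStronglyPrime.mul {u v p q : F[X]} (hp : IsStronglyPrime u v p)
    (hq : IsStronglyPrime u v q) : IsStronglyPrime u v (p * q) :=
  ⟨mul_ne_zero hp.1 hq.1, fun i =>
    ⟨(hp.2 i).1.mul_left (hq.2 i).1, (hp.2 i).2.mul_left (hq.2 i).2⟩⟩

theorem IsStronglyPrime.pow {u v p : F[X]} (hp : IsStronglyPrime u v p) (n : ℕ) :
    IsStronglyPrime u v (p ^ n) :=
  ⟨pow_ne_zero n hp.1, fun i => ⟨(hp.2 i).1.pow_left, (hp.2 i).2.pow_left⟩⟩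

theorem IsStronglyPrime.of_dvd {u v p q : F[X]} (hp : IsStronglyPrime u v p) (h : q ∣ p) :
    IsStronglyPrime u v q :=
  ⟨ne_zero_of_dvd_ne_zero hp.1 h, fun i =>
    ⟨(hp.2 i).1.of_isCoprime_of_dvd_left h, (hp.2 i).2.of_isCoprime_of_dvd_left h⟩⟩

theorem isStronglyPrime_one (u v : F[X]) : IsStronglyPrime u v 1 :=
  ⟨one_ne_zero, fun _ => ⟨isCoprime_one_left, isCoprime_one_left⟩⟩

theorem isShiftFree_one : IsShiftFree (1 : F[X]) :=
  ⟨one_ne_zero, fun _ _ => isCoprime_one_left⟩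

/-- Multiplying a shift-free polynomial with a power of one of its factors keeps it shift-free. -/
theorem IsShiftFree.mul_pow_of_dvd {b q : F[X]} (hb : IsShiftFree b) (hq : q ∣ b) (k : ℕ) :
    IsShiftFree (b * q ^ k) := by
  refine ⟨mul_ne_zero hb.1 (pow_ne_zero k (ne_zero_of_dvd_ne_zero hb.1 hq)), fun i hi => ?_⟩
  have h := hb.2 i hi
  have hs := shiftPoly_dvd_shiftPoly i hq
  rw [shiftPoly_mul, shiftPoly_pow]
  exact IsCoprime.mul_left
    (h.mul_right (h.of_isCoprime_of_dvd_right hs).pow_right)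
    (IsCoprime.mul_right (h.of_isCoprime_of_dvd_left hq).pow_left
      ((h.of_isCoprime_of_dvd_left hq).of_isCoprime_of_dvd_right hs).pow)

/-- Multiplying a shift-free polynomial with a power of an irreducible polynomial none of whose
shifts divides it keeps it shift-free. -/
theorem IsShiftFree.mul_pow_of_irreducible [CharZero F] {b q : F[X]} (hb : IsShiftFree b)
    (hq : Irreducible q) (h : ∀ i : ℤ, ¬ shiftPoly i q ∣ b) (k : ℕ) :
    IsShiftFree (b * q ^ k) := by
  have hc (i : ℤ) : IsCoprime (shiftPoly i q) b :=
    (EuclideanDomain.dvd_or_coprime _ b (irreducible_shiftPoly i hq)).resolve_left (h i)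
  refine ⟨mul_ne_zero hb.1 (pow_ne_zero k hq.ne_zero), fun i hi => ?_⟩
  rw [shiftPoly_mul, shiftPoly_pow]
  refine IsCoprime.mul_left ((hb.2 i hi).mul_right (hc i).symm.pow_right)
    (IsCoprime.mul_right (IsCoprime.pow_left ?_) ((isShiftFree_of_irreducible hq).2 i hi).pow)
  have := (isCoprime_shiftPoly_iff (-i) 0 q b).1 (by simpa using hc (-i))
  simpa using this

/-- Some shift of an irreducible polynomial is strongly prime with a given shift-reduced rational
function. -/
theorem exists_isStronglyPrime_shiftPoly [CharZero F] {u v p : F[X]} (hu : u ≠ 0) (hv : v ≠ 0)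
    (huv : ∀ i : ℤ, IsCoprime u (shiftPoly i v)) (hp : Irreducible p) :
    ∃ n : ℤ, IsStronglyPrime u v (shiftPoly n p) := by
  have hcop (j : ℤ) (f : F[X]) : shiftPoly j p ∣ f ∨ IsCoprime (shiftPoly j p) f :=
    EuclideanDomain.dvd_or_coprime _ f (irreducible_shiftPoly j hp)
  have hfin {f : F[X]} (hf : f ≠ 0) : {j : ℤ | shiftPoly j p ∣ f}.Finite := by
    obtain ⟨z, hz⟩ := exists_aeval_eq_zero_of_irreducible hp
    refine Set.Finite.of_finite_image (f := fun j : ℤ => -j)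
      ((finite_setOf_aeval_add_intCast hf z).subset ?_) (neg_injective.injOn)
    rintro _ ⟨j, hj, rfl⟩
    refine aeval_eq_zero_of_dvd_aeval_eq_zero hj ?_
    rw [aeval_shiftPoly]
    simpa using hz
  -- By shift-reducedness the orbit of `p` meets the factors of at most one of `u` and `v`. If it
  -- meets `v`, shift to below all its members dividing `v`; otherwise to above all those dividing
  -- `u`.
  by_cases hex : ∃ j : ℤ, shiftPoly j p ∣ v
  · obtain ⟨j, hj⟩ := hex
    obtain ⟨m, hm⟩ := (hfin hv).bddBelow
    refine ⟨m - 1, shiftPoly_ne_zero _ hp.ne_zero, fun i => ⟨?_, ?_⟩⟩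
    · have h1 := (huv (m - 1 - j + i)).symm.of_isCoprime_of_dvd_left
        (shiftPoly_dvd_shiftPoly (m - 1 - j + i) hj)
      rw [shiftPoly_shiftPoly] at h1
      rw [isCoprime_shiftPoly_iff]
      have h2 := (isCoprime_shiftPoly_iff _ 0 p u).1 (by simpa using h1)
      convert h2 using 2
      ring
    · have h1 := (hcop (m - 1 - i) v).resolve_left fun hd => by
        have := hm hd
        omega
      rw [isCoprime_shiftPoly_iff]
      have h2 := (isCoprime_shiftPoly_iff _ 0 p v).1 (by simpa using h1)
      convert h2 using 2
      ring
  · push Not at hex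
    obtain ⟨m, hm⟩ := (hfin hu).bddAbove
    refine ⟨m + 1, shiftPoly_ne_zero _ hp.ne_zero, fun i => ⟨?_, ?_⟩⟩
    · have h1 := (hcop (m + 1 + i) u).resolve_left fun hd => by
        have := hm hd
        omega
      rw [isCoprime_shiftPoly_iff]
      have h2 := (isCoprime_shiftPoly_iff _ 0 p u).1 (by simpa using h1)
      convert h2 using 2
      ring
    · have h1 := (hcop (m + 1 - i) v).resolve_left (hex _)
      rw [isCoprime_shiftPoly_iff]
      have h2 := (isCoprime_shiftPoly_iff _ 0 p v).1 (by simpa using h1)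
      convert h2 using 2
      ring

/-- `x` is congruent to a fraction with denominator `b σ_y⁻¹(u) v` modulo `V_K`, `K = u / v`. -/
def ReducesTo (u v b : F[X]) (x : RatFunc F) : Prop :=
  ∃ (S₁ : RatFunc F) (w : F[X]),
    x = frac u v * shift S₁ - S₁ + frac w (b * shiftPoly (-1) u * v)

/-! ### Moving denominators along shift orbits modulo `V_K`. -/

section ReducesTo

variable {u v : F[X]}

theorem ReducesTo.add {b : F[X]} {x y : RatFunc F} (hx : ReducesTo u v b x)
    (hy : ReducesTo u v b y) : ReducesTo u v b (x + y) := by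
  obtain ⟨S, w, rfl⟩ := hx
  obtain ⟨S', w', rfl⟩ := hy
  refine ⟨S + S', w + w', ?_⟩
  rw [← frac_add_frac_same, map_add]
  ring

theorem ReducesTo.mul_right {b c : F[X]} {x : RatFunc F} (hx : ReducesTo u v b x) (hc : c ≠ 0) :
    ReducesTo u v (b * c) x := by
  obtain ⟨S, w, rfl⟩ := hx
  refine ⟨S, c * w, ?_⟩
  rw [show b * c * shiftPoly (-1) u * v = c * (b * shiftPoly (-1) u * v) by ring,
    frac_mul_left _ hc]

theorem ReducesTo.mul_left {b c : F[X]} {x : RatFunc F} (hx : ReducesTo u v b x) (hc : c ≠ 0) :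
    ReducesTo u v (c * b) x := by
  rw [mul_comm]
  exact hx.mul_right hc

theorem ReducesTo.add_difference {b : F[X]} {y : RatFunc F} (hy : ReducesTo u v b y)
    (w : RatFunc F) : ReducesTo u v b (frac u v * shift w - w + y) := by
  obtain ⟨S, p, rfl⟩ := hy
  exact ⟨S + w, p, by rw [map_add]; ring⟩

theorem reducesTo_frac_of_dvd (hu : u ≠ 0) (hv : v ≠ 0) {b d : F[X]} (hb : b ≠ 0)
    (h : d ∣ b * shiftPoly (-1) u * v) (p : F[X]) : ReducesTo u v b (frac p d) := by
  obtain ⟨c, hc⟩ := h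
  have hc0 : c ≠ 0 := by
    rintro rfl
    rw [mul_zero] at hc
    exact mul_ne_zero (mul_ne_zero hb (shiftPoly_ne_zero _ hu)) hv hc
  refine ⟨0, c * p, ?_⟩
  rw [hc, mul_comm d c, frac_mul_left _ hc0]
  simp

/-- Modulo `V_K`, `p / q` equals `K σ(p / q)`, whose denominator `v σ(q)` splits by coprimality.
Each of the `n` moves needs one instance of `h`. -/
theorem reducesTo_shiftPoly_natCast (hu : u ≠ 0) (hv : v ≠ 0) (n : ℕ) {q : F[X]} (hq : q ≠ 0)
    (h : ∀ i : ℕ, IsCoprime (shiftPoly n q) (shiftPoly i v)) (p : F[X]) :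
    ReducesTo u v (shiftPoly n q) (frac p q) := by
  induction n generalizing p q with
  | zero =>
    simpa using reducesTo_frac_of_dvd hu hv hq
      ((dvd_mul_right q (shiftPoly (-1) u)).trans (dvd_mul_right _ v)) p
  | succ n ih =>
    have hq1 := shiftPoly_ne_zero 1 hq
    have e : shiftPoly ((n + 1 : ℕ) : ℤ) q = shiftPoly n (shiftPoly 1 q) := by
      rw [shiftPoly_shiftPoly]
      simp
    have hcop : IsCoprime (shiftPoly 1 q) v := by
      have := h n
      rw [e, isCoprime_shiftPoly_iff] at this
      simpa using this
    obtain ⟨s, t, hst⟩ := exists_frac_mul_eq_add (u * shiftPoly 1 p) hq1 hv hcop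
    have key : frac p q = frac u v * shift (-frac p q) - (-frac p q) +
        (frac s (shiftPoly 1 q) + frac t v) := by
      rw [← hst, map_neg, shift_frac, mul_neg, frac_mul_frac, mul_comm v]
      ring
    rw [key]
    refine ReducesTo.add_difference (ReducesTo.add ?_ ?_) _
    · rw [e]
      exact ih hq1 (fun i => e ▸ h i) s
    · exact reducesTo_frac_of_dvd hu hv (shiftPoly_ne_zero _ hq) (dvd_mul_left _ _) t

/-- The backward move solves `K σ(w) = p / q` and replaces `p / q` by `w`. The denominator of `w` is
`σ⁻¹(q) σ⁻¹(u)`, which is why `σ⁻¹(u)` has to be allowed in the reduced form. -/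
theorem reducesTo_shiftPoly_neg_natCast (hu : u ≠ 0) (hv : v ≠ 0) (n : ℕ) {q : F[X]} (hq : q ≠ 0)
    (h : ∀ i : ℕ, IsCoprime (shiftPoly (-n) q) (shiftPoly (-i) u)) (p : F[X]) :
    ReducesTo u v (shiftPoly (-n) q) (frac p q) := by
  induction n generalizing p q with
  | zero =>
    simpa using reducesTo_frac_of_dvd hu hv hq
      ((dvd_mul_right q (shiftPoly (-1) u)).trans (dvd_mul_right _ v)) p
  | succ n ih =>
    have hq1 := shiftPoly_ne_zero (-1) hq
    have e : shiftPoly (-((n + 1 : ℕ) : ℤ)) q = shiftPoly (-n) (shiftPoly (-1) q) := by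
      rw [shiftPoly_shiftPoly]
      congr 1
      push_cast
      ring
    have hcop : IsCoprime (shiftPoly (-1) q) (shiftPoly (-1) u) := by
      have := h (n + 1)
      rw [isCoprime_shiftPoly_iff] at this ⊢
      simpa using this
    obtain ⟨s, t, hst⟩ := exists_frac_mul_eq_add (shiftPoly (-1) v * shiftPoly (-1) p) hq1
      (shiftPoly_ne_zero (-1) hu) hcop
    have key : frac p q = frac u v * shift
        (frac (shiftPoly (-1) v * shiftPoly (-1) p) (shiftPoly (-1) q * shiftPoly (-1) u)) -
        frac (shiftPoly (-1) v * shiftPoly (-1) p) (shiftPoly (-1) q * shiftPoly (-1) u) +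
        (frac s (shiftPoly (-1) q) + frac t (shiftPoly (-1) u)) := by
      rw [← hst, shift_frac, sub_add_cancel, frac_mul_frac]
      simp only [← shiftPoly_mul, shiftPoly_shiftPoly, add_neg_cancel, shiftPoly_zero]
      rw [show u * (v * p) = (u * v) * p by ring, show v * (q * u) = (u * v) * q by ring,
        frac_mul_left _ (mul_ne_zero hu hv)]
    rw [key]
    refine ReducesTo.add_difference (ReducesTo.add ?_ ?_) _
    · rw [e]
      exact ih hq1 (fun i => e ▸ h i) s
    · exact reducesTo_frac_of_dvd hu hv (shiftPoly_ne_zero _ hq)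
        ((dvd_mul_left _ _).trans (dvd_mul_right _ _)) t

theorem reducesTo_shiftPoly (hu : u ≠ 0) (hv : v ≠ 0) (n : ℤ) {q : F[X]} (hq : q ≠ 0)
    (h : IsStronglyPrime u v (shiftPoly n q)) (p : F[X]) :
    ReducesTo u v (shiftPoly n q) (frac p q) := by
  obtain ⟨m, rfl | rfl⟩ := n.eq_nat_or_neg
  · exact reducesTo_shiftPoly_natCast hu hv m hq (fun i => (h.2 i).2) p
  · exact reducesTo_shiftPoly_neg_natCast hu hv m hq (fun i => (h.2 i).1) p

/-- Partial fractions add one prime power at a time, with `b` accumulating the denominators already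
treated; this is what keeps different summands on the same orbit representatives. -/
theorem exists_reducesTo_add_frac [CharZero F] (hu : u ≠ 0) (hv : v ≠ 0)
    (huv : ∀ i : ℤ, IsCoprime u (shiftPoly i v)) (d : F[X]) {b : F[X]} (hb : IsShiftFree b)
    (hbK : IsStronglyPrime u v b) {x : RatFunc F} (hx : ReducesTo u v b x) (p : F[X]) :
    ∃ b' : F[X], IsShiftFree b' ∧ IsStronglyPrime u v b' ∧ ReducesTo u v b' (x + frac p d) := by
  induction d using UniqueFactorizationMonoid.induction_on_coprime generalizing b x p with
  | h0 => exact ⟨b, hb, hbK, by simpa [frac] using hx⟩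
  | h1 hd =>
    exact ⟨b, hb, hbK, hx.add (reducesTo_frac_of_dvd hu hv hb.1 hd.dvd p)⟩
  | hpr k hd =>
    rename_i d
    have hirr : Irreducible d := hd.irreducible
    -- If the orbit of `d` already occurs in `b`, its member there must be reused, or `b` would
    -- cease to be shift-free; otherwise any strongly prime member will do.
    obtain ⟨n, hn, hfree⟩ : ∃ n : ℤ, IsStronglyPrime u v (shiftPoly n d) ∧
        IsShiftFree (b * shiftPoly n d ^ k) := by
      by_cases hex : ∃ n : ℤ, shiftPoly n d ∣ b
      · obtain ⟨n, hn⟩ := hex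
        exact ⟨n, hbK.of_dvd hn, hb.mul_pow_of_dvd hn k⟩
      · push Not at hex
        obtain ⟨n, hn⟩ := exists_isStronglyPrime_shiftPoly hu hv huv hirr
        refine ⟨n, hn, hb.mul_pow_of_irreducible (irreducible_shiftPoly n hirr) (fun i => ?_) k⟩
        rw [shiftPoly_shiftPoly]
        exact hex _
    have hpow : IsStronglyPrime u v (shiftPoly n (d ^ k)) := by
      rw [shiftPoly_pow]
      exact hn.pow k
    refine ⟨b * shiftPoly n d ^ k, hfree, hbK.mul (hn.pow k), ?_⟩
    rw [← shiftPoly_pow]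
    exact (hx.mul_right hpow.1).add
      ((reducesTo_shiftPoly hu hv n (pow_ne_zero k hirr.ne_zero) hpow p).mul_left hb.1)
  | hcp hde ihd ihe =>
    rename_i d e
    by_cases h0 : d = 0 ∨ e = 0
    · exact ⟨b, hb, hbK, by
        have h0 : d * e = 0 := by simpa using h0
        simpa [frac, h0] using hx⟩
    push Not at h0
    obtain ⟨s, t, hst⟩ := exists_frac_mul_eq_add p h0.1 h0.2 (isRelPrime_iff_isCoprime.1 hde)
    obtain ⟨b₁, h₁, h₁', hx₁⟩ := ihd hb hbK hx s
    obtain ⟨b₂, h₂, h₂', hx₂⟩ := ihe h₁ h₁' hx₁ t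
    exact ⟨b₂, h₂, h₂', by rwa [hst, ← add_assoc]⟩

end ReducesTo

/-- The Abramov–Petkovšek reduction is always possible. -/
theorem exists_isAPReduction [CharZero F] {u v : F[X]} (hu : u ≠ 0) (hv : v ≠ 0)
    (huv : ∀ i : ℤ, IsCoprime u (shiftPoly i v)) (S : RatFunc F) :
    ∃ (S₁ : RatFunc F) (b w : F[X]), IsAPReduction (frac u v) u v S S₁ b w := by
  have h0 : ReducesTo u v 1 0 := ⟨0, 0, by simp [frac]⟩
  obtain ⟨b, hb, hbK, S₁, w, h⟩ := exists_reducesTo_add_frac hu hv huv S.denom isShiftFree_one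
    (isStronglyPrime_one u v) h0 S.num
  rw [zero_add, frac_num_denom] at h
  exact ⟨S₁, b, w, hb, hbK, h⟩

/-- The three factors `b`, `σ⁻¹(u)`, `v` are pairwise coprime, so two partial fraction splittings
suffice. -/
theorem exists_isShellReduction [CharZero F] {u v : F[X]} (hu : u ≠ 0) (hv : v ≠ 0)
    (huv : ∀ i : ℤ, IsCoprime u (shiftPoly i v)) (S : RatFunc F) :
    ∃ (g : RatFunc F) (s b t : F[X]), IsShellReduction (frac u v) u v S g s b t := by
  obtain ⟨S₁, b, w, h⟩ := exists_isAPReduction hu hv huv S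
  have hu' := shiftPoly_ne_zero (-1) hu
  have hbu : IsCoprime b (shiftPoly (-1) u) := by simpa using (h.2.1.2 1).1
  have hbv : IsCoprime b v := by simpa using (h.2.1.2 0).2
  have huv' : IsCoprime (shiftPoly (-1) u) v := by
    have := (isCoprime_shiftPoly_iff (-1) 0 u v).2 (huv _)
    simpa using this
  obtain ⟨w', p₂, h₁⟩ := exists_frac_mul_eq_add w (mul_ne_zero h.1.1 hu') hv (hbv.mul_left huv')
  obtain ⟨s, p₁, h₂⟩ := exists_frac_mul_eq_add w' h.1.1 hu' hbu
  exact ⟨_, s, b, _, S₁, w, p₁, p₂, h, by rw [h₁, h₂], rfl, rfl⟩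

end ShellReduction

/-! ### Polynomial reduction -/

section PolynomialReduction

/-- A submodule of `F[X]` is determined by the degrees of the elements of a smaller one. -/
theorem le_of_forall_exists_degree_eq {M N : Submodule F F[X]} (hMN : M ≤ N)
    (h : ∀ p ∈ N, p ≠ 0 → ∃ e ∈ M, e.degree = p.degree) : N ≤ M := by
  intro p hp
  induction hd : p.degree using WellFoundedLT.induction generalizing p with
  | ind d ih =>
    by_cases hp0 : p = 0
    · rw [hp0]
      exact M.zero_mem
    obtain ⟨e, he, hed⟩ := h p hp hp0
    have he0 : e ≠ 0 := by
      rintro rfl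
      rw [degree_zero, eq_comm, degree_eq_bot] at hed
      exact hp0 hed
    have hc : p.leadingCoeff / e.leadingCoeff ≠ 0 :=
      div_ne_zero (leadingCoeff_ne_zero.2 hp0) (leadingCoeff_ne_zero.2 he0)
    set e' := (p.leadingCoeff / e.leadingCoeff) • e with he'
    have hlc : e'.leadingCoeff = p.leadingCoeff := by
      rw [he', smul_eq_C_mul, leadingCoeff_mul, leadingCoeff_C,
        div_mul_cancel₀ _ (leadingCoeff_ne_zero.2 he0)]
    have hdeg : p.degree = e'.degree := by
      rw [he', smul_eq_C_mul, degree_C_mul hc, hed]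
    have hM : e' ∈ M := M.smul_mem _ he
    -- `e'` has the leading term of `p`, so `p - e'` has smaller degree and still lies in `N`.
    have := ih _ (hd ▸ degree_sub_lt_left hdeg hp0 hlc.symm) (N.sub_mem hp (hMN hM)) rfl
    simpa using M.add_mem this hM

/-- The degree of a nonzero linear combination of polynomials with distinct degrees is one of these
degrees. -/
theorem exists_degree_eq_of_mem_span_range {ι : Type*} {e : ι → F[X]}
    (he : Function.Injective fun i => (e i).degree) {p : F[X]}
    (hp : p ∈ Submodule.span F (Set.range e)) (hp0 : p ≠ 0) : ∃ i, (e i).degree = p.degree := by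
  obtain ⟨c, rfl⟩ := (Finsupp.mem_span_range_iff_exists_finsupp).1 hp
  have hdeg (i : ι) (hi : i ∈ c.support) : (c i • e i).degree = (e i).degree := by
    rw [smul_eq_C_mul, degree_C_mul (Finsupp.mem_support_iff.1 hi)]
  have hsum : (c.sum fun i a => a • e i).degree = c.support.sup fun i => (c i • e i).degree := by
    refine degree_sum_eq_of_disjoint _ _ ?_
    rintro i ⟨hi, -⟩ j ⟨hj, -⟩ hij h
    simp only [Function.comp, hdeg i hi, hdeg j hj] at h
    exact hij (he h)
  have hne : c.support.Nonempty := by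
    rw [Finset.nonempty_iff_ne_empty]
    intro h
    exact hp0 (by simp [Finsupp.sum, h])
  obtain ⟨i, hi, hsup⟩ := Finset.exists_mem_eq_sup _ hne fun i => (c i • e i).degree
  exact ⟨i, by rw [hsum, hsup, hdeg i hi]⟩

variable {u v : F[X]}

/-- A nonzero `p` in the kernel would give `K = p / σ(p)`, which is `σ(r) / r` for `r = 1 / p`. -/
theorem phi_injective (hv : v ≠ 0) (h : ∀ r : RatFunc F, r ≠ 0 → frac u v ≠ shift r / r) :
    Function.Injective (phi u v) := by
  rw [← LinearMap.ker_eq_bot, LinearMap.ker_eq_bot']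
  intro p hp
  by_contra hp0
  rw [phi_apply, sub_eq_zero] at hp
  refine h (frac 1 p) (frac_ne_zero one_ne_zero hp0) ?_
  have h1 := shiftPoly_ne_zero 1 hp0
  rw [shift_frac, shiftPoly_one]
  have e : frac u v = frac p (shiftPoly 1 p) := by
    rw [frac_eq_frac_iff hv h1, hp, mul_comm]
  rw [e]
  have := algebraMap_ratFunc_ne_zero h1
  have := algebraMap_ratFunc_ne_zero hp0
  simp only [frac, map_one]
  field_simp

theorem coeff_eq_zero_of_mem_standardComplement {q : F[X]} (hq : q ∈ standardComplement u v)
    {p : F[X]} (hp : p ∈ LinearMap.range (phi u v)) {l : ℕ} (hl : p.degree = l) :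
    q.coeff l = 0 := by
  induction hq using Submodule.span_induction with
  | mem m hm =>
    obtain ⟨k, hk, rfl⟩ := hm
    rw [coeff_X_pow, if_neg]
    rintro rfl
    exact hk p hp hl
  | zero => simp
  | add _ _ _ _ h₁ h₂ => simp [h₁, h₂]
  | smul _ _ _ h => simp [h]

theorem eq_zero_of_mem_standardComplement_of_mem_range {q : F[X]}
    (hq : q ∈ standardComplement u v) (hr : q ∈ LinearMap.range (phi u v)) : q = 0 := by
  by_contra h0
  exact leadingCoeff_ne_zero.2 h0
    (coeff_eq_zero_of_mem_standardComplement hq hr (degree_eq_natDegree h0))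

/-- With bounded degrees, `φ_K` would embed the infinite-dimensional `F[y]` into a
finite-dimensional space. -/
theorem infinite_setOf_degree_eq (hφ : Function.Injective (phi u v)) :
    {l : ℕ | ∃ p : F[X], (phi u v p).degree = l}.Infinite := by
  intro hfin
  obtain ⟨N, hN⟩ := hfin.bddAbove
  have hmem (p : F[X]) : phi u v p ∈ degreeLT F (N + 1) := by
    rw [mem_degreeLT]
    by_cases h0 : phi u v p = 0
    · rw [h0, degree_zero]
      exact WithBot.bot_lt_coe _
    · have := hN ⟨p, degree_eq_natDegree h0⟩
      rw [degree_eq_natDegree h0]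
      exact_mod_cast Nat.lt_succ_of_le this
  have : Module.Finite F (degreeLT F (N + 1)) :=
    Module.Finite.equiv (degreeLTEquiv F (N + 1)).symm
  have hinj : Function.Injective ((phi u v).codRestrict (degreeLT F (N + 1)) hmem) :=
    fun p q h => hφ (congrArg Subtype.val h)
  exact Polynomial.not_finite (R := F) (Module.Finite.of_injective _ hinj)

theorem exists_isEchelonSequence (hφ : Function.Injective (phi u v)) :
    ∃ P : ℕ → F[X], IsEchelonSequence u v P := by
  have hinf := infinite_setOf_degree_eq hφ
  -- `P n` is any polynomial whose image has the `n`-th smallest attained degree.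
  choose P hP using fun n => Nat.nth_mem_of_infinite hinf n
  refine ⟨P, fun i h => ?_, fun i => ?_, le_antisymm ?_ ?_⟩
  · simpa [h] using hP i
  · rw [hP, hP]
    exact_mod_cast Nat.nth_strictMono hinf (Nat.lt_succ_self i)
  · rw [Submodule.span_le]
    rintro _ ⟨i, rfl⟩
    exact ⟨P i, rfl⟩
  · refine le_of_forall_exists_degree_eq ?_ ?_
    · rw [Submodule.span_le]
      rintro _ ⟨i, rfl⟩
      exact ⟨P i, rfl⟩
    · rintro _ ⟨p, rfl⟩ h0
      have hmem : (phi u v p).natDegree ∈ {l : ℕ | ∃ p : F[X], (phi u v p).degree = l} :=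
        ⟨p, degree_eq_natDegree h0⟩
      rw [← Nat.range_nth_of_infinite hinf] at hmem
      obtain ⟨i, hi⟩ := hmem
      refine ⟨phi u v (P i), Submodule.subset_span ⟨i, rfl⟩, ?_⟩
      rw [hP, hi, degree_eq_natDegree h0]

theorem IsEchelonSequence.strictMono {P : ℕ → F[X]} (hP : IsEchelonSequence u v P) :
    StrictMono fun i => (phi u v (P i)).degree :=
  strictMono_nat_of_lt_succ hP.2.1

theorem IsEchelonSequence.strictMono_natDegree {P : ℕ → F[X]} (hP : IsEchelonSequence u v P) :
    StrictMono fun i => (phi u v (P i)).natDegree := by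
  intro i j hij
  exact natDegree_lt_natDegree (hP.1 i) (hP.strictMono hij)

theorem IsEchelonSequence.exists_forall_lt_iff {P : ℕ → F[X]} (hP : IsEchelonSequence u v P)
    {p : F[X]} (hp : p ≠ 0) : ∃ n : ℕ, ∀ i, i < n ↔ (phi u v (P i)).degree ≤ p.degree := by
  have hex : ∃ i, p.degree < (phi u v (P i)).degree := by
    -- A strictly increasing sequence of natural numbers satisfies `i ≤ d i`, so this index is large
    -- enough.
    refine ⟨p.natDegree + 1, ?_⟩
    rw [degree_eq_natDegree hp, degree_eq_natDegree (hP.1 _)]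
    exact_mod_cast Nat.lt_of_succ_le (hP.strictMono_natDegree.le_apply (x := p.natDegree + 1))
  classical
  refine ⟨Nat.find hex, fun i => ⟨fun hi => not_lt.1 (Nat.find_min hex hi), fun hi => ?_⟩⟩
  by_contra hn
  exact absurd (hi.trans_lt (Nat.find_spec hex)) (hP.strictMono.monotone (not_lt.1 hn)).not_gt

/-- Polynomial reduction is always possible. -/
theorem IsEchelonSequence.exists_isPolynomialReduction {P : ℕ → F[X]}
    (hP : IsEchelonSequence u v P) (p : F[X]) :
    ∃ h q : F[X], IsPolynomialReduction u v P p h q := by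
  by_cases hp : p = 0
  · exact ⟨0, 0, Or.inl ⟨hp, rfl, rfl⟩⟩
  obtain ⟨n, hn⟩ := hP.exists_forall_lt_iff hp
  set M := Submodule.span F ((fun i => phi u v (P i)) '' (Finset.range n : Set ℕ)) ⊔
    standardComplement u v
  -- Every degree up to `deg p` is either that of some `φ_K(P i)` with `i < n` or a gap, whose
  -- monomial lies in `W_K`. Intersecting with `degreeLE` supplies the inclusion needed for
  -- comparing degrees.
  have hle : degreeLE F p.degree ≤ M ⊓ degreeLE F p.degree := by
    refine le_of_forall_exists_degree_eq inf_le_right fun x hx hx0 => ?_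
    rw [mem_degreeLE] at hx
    by_cases hr : ∃ y ∈ LinearMap.range (phi u v), y.degree = x.degree
    · obtain ⟨y, hy, hyx⟩ := hr
      have hy0 : y ≠ 0 := by
        rintro rfl
        rw [degree_zero, eq_comm, degree_eq_bot] at hyx
        exact hx0 hyx
      rw [← hP.2.2] at hy
      obtain ⟨i, hi⟩ := exists_degree_eq_of_mem_span_range hP.strictMono.injective hy hy0
      have hile : (phi u v (P i)).degree ≤ p.degree := by rw [hi, hyx]; exact hx
      exact ⟨phi u v (P i), ⟨Submodule.mem_sup_left (Submodule.subset_span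
        ⟨i, by simpa using (hn i).2 hile, rfl⟩), mem_degreeLE.2 hile⟩, by rw [hi, hyx]⟩
    · push Not at hr
      refine ⟨X ^ x.natDegree, ⟨Submodule.mem_sup_right (Submodule.subset_span
        ⟨x.natDegree, ?_, rfl⟩), ?_⟩, ?_⟩
      · rwa [← degree_eq_natDegree hx0]
      · refine mem_degreeLE.2 ?_
        rwa [degree_X_pow, ← degree_eq_natDegree hx0]
      · rw [degree_X_pow, degree_eq_natDegree hx0]
  obtain ⟨y, hy, q, hq, hyq⟩ := Submodule.mem_sup.1 (hle (mem_degreeLE.2 le_rfl)).1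
  obtain ⟨c, rfl⟩ := (Submodule.mem_span_image_finset_iff_exists_fun' F).1 hy
  refine ⟨∑ i ∈ Finset.range n, c i • P i, q, Or.inr ⟨hp, n, c, hn, rfl, ?_, hq⟩⟩
  rw [← hyq, map_sum]
  simp

theorem IsPolynomialReduction.eq_sub {P : ℕ → F[X]} {p h q : F[X]}
    (hr : IsPolynomialReduction u v P p h q) : q = p - phi u v h := by
  rcases hr with ⟨rfl, rfl, rfl⟩ | ⟨-, -, -, -, -, h, -⟩
  · simp
  · exact h

theorem IsPolynomialReduction.mem_standardComplement {P : ℕ → F[X]} {p h q : F[X]}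
    (hr : IsPolynomialReduction u v P p h q) : q ∈ standardComplement u v := by
  rcases hr with ⟨-, -, rfl⟩ | ⟨-, -, -, -, -, -, h⟩
  · exact Submodule.zero_mem _
  · exact h

end PolynomialReduction

/-! ### Uniqueness of residual forms of zero -/

section Uniqueness

variable {u v b : F[X]}

theorem frac_mul_shift_frac_sub_frac (hv : v ≠ 0) {c d : F[X]} (hd : d ≠ 0) :
    frac u v * shift (frac c d) - frac c d =
      frac (u * shiftPoly 1 c * d - v * shiftPoly 1 d * c) (v * shiftPoly 1 d * d) := by
  have h1 := algebraMap_ratFunc_ne_zero (shiftPoly_ne_zero 1 hd)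
  have h2 := algebraMap_ratFunc_ne_zero hd
  have h3 := algebraMap_ratFunc_ne_zero hv
  rw [shift_frac]
  simp only [frac, map_mul, map_sub]
  field_simp

/-- If `K σ_y(w) - w` has a shift-free denominator `b v` with `b` strongly prime with the
shift-reduced `K = u / v`, then `w` is a polynomial. -/
theorem denom_eq_one_of_difference_eq [CharZero F] (hv : v ≠ 0)
    (huv : ∀ i : ℤ, IsCoprime u (shiftPoly i v)) (hb : IsShiftFree b)
    (hbK : IsStronglyPrime u v b) {w : RatFunc F} {p : F[X]}
    (h : frac u v * shift w - w = frac p (b * v)) : w.denom = 1 := by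
  by_contra hne
  have hd0 := w.denom_ne_zero
  have hcop := w.isCoprime_num_denom
  rw [← frac_num_denom w, frac_mul_shift_frac_sub_frac hv hd0,
    frac_eq_frac_iff (mul_ne_zero (mul_ne_zero hv (shiftPoly_ne_zero 1 hd0)) hd0)
      (mul_ne_zero hb.1 hv)] at h
  have hdeg : w.denom.degree ≠ 0 := fun h0 =>
    hne ((RatFunc.monic_denom w).eq_one_of_isUnit (isUnit_iff_degree_eq_zero.2 h0))
  set c := w.num
  set d := w.denom
  have key : u * shiftPoly 1 c * d * b - v * shiftPoly 1 d * c * b = p * shiftPoly 1 d * d :=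
    mul_right_cancel₀ hv (by linear_combination h)
  -- On the orbit `z + ℤ` let `z + m` and `z + M` be the extreme roots of `d`. Then `σ(d)` vanishes
  -- but `d` does not at `x = z + m - 1`, and conversely at `y = z + M`. Evaluating `key` there
  -- forces `u b` to vanish at `x` and `v b` at `y = x + k`, with `k ≥ 1`.
  obtain ⟨z, hz⟩ := IsAlgClosed.exists_aeval_eq_zero (AlgebraicClosure F) d hdeg
  have hfin := finite_setOf_aeval_add_intCast hd0 z
  set A := {i : ℤ | aeval (z + (i : AlgebraicClosure F)) d = 0} with hA
  have h0 : (0 : ℤ) ∈ A := by simpa [hA] using hz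
  obtain ⟨m, hm, hmin⟩ := hfin.exists_minimal ⟨0, h0⟩
  obtain ⟨M, hM, hmax⟩ := hfin.exists_maximal ⟨0, h0⟩
  have hm1 : m - 1 ∉ A := fun hc => by
    have := hmin hc (by omega)
    omega
  have hM1 : M + 1 ∉ A := fun hc => by
    have := hmax hc (by omega)
    omega
  have hmM : m ≤ M := by
    by_contra hlt
    have := hmin hM (by omega)
    omega
  set x : AlgebraicClosure F := z + ((m - 1 : ℤ) : AlgebraicClosure F) with hx
  set k : ℤ := M - m + 1 with hk
  have hxk : x + (k : AlgebraicClosure F) = z + (M : AlgebraicClosure F) := by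
    rw [hx, hk]
    push_cast
    ring
  set y : AlgebraicClosure F := x + (k : AlgebraicClosure F) with hy
  have dx : aeval x d ≠ 0 := hm1
  have dx1 : aeval x (shiftPoly 1 d) = 0 := by
    rw [aeval_shiftPoly, hx]
    have : aeval (z + (m : AlgebraicClosure F)) d = 0 := hm
    rw [← this]
    congr 2
    push_cast
    ring
  have cx1 : aeval x (shiftPoly 1 c) ≠ 0 :=
    not_aeval_eq_zero_of_isCoprime (isCoprime_shiftPoly_shiftPoly 1 hcop.symm) dx1
  have dy : aeval y d = 0 := by
    rw [hxk]
    exact hM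
  have dy1 : aeval y (shiftPoly 1 d) ≠ 0 := by
    rw [aeval_shiftPoly, hxk]
    have : z + (M : AlgebraicClosure F) + ((1 : ℤ) : AlgebraicClosure F) =
        z + ((M + 1 : ℤ) : AlgebraicClosure F) := by
      push_cast
      ring
    rw [this]
    exact hM1
  have cy : aeval y c ≠ 0 := not_aeval_eq_zero_of_isCoprime hcop.symm dy
  have hX : aeval x u = 0 ∨ aeval x b = 0 := by
    have := congrArg (aeval x) key
    simpa [dx, dx1, cx1] using this
  have hY : aeval y v = 0 ∨ aeval y b = 0 := by
    have := congrArg (aeval y) key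
    simpa [dy, dy1, cy] using this
  have hk0 : k ≠ 0 := by omega
  have hkn : ((k.toNat : ℕ) : ℤ) = k := Int.toNat_of_nonneg (by omega)
  have hxy : y + ((-k : ℤ) : AlgebraicClosure F) = x := by
    rw [hy]
    push_cast
    ring
  -- The four cases contradict, in order, shift-reducedness of `K`, the two halves of strong
  -- primeness, and shift-freeness of `b`.
  rcases hX with hX | hX <;> rcases hY with hY | hY
  · exact not_aeval_eq_zero_of_isCoprime (huv k) hX (by rwa [aeval_shiftPoly])
  · have := (hbK.2 k.toNat).1
    rw [hkn] at this
    exact not_aeval_eq_zero_of_isCoprime this hY (by rwa [aeval_shiftPoly, hxy])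
  · have := (hbK.2 k.toNat).2
    rw [hkn] at this
    exact not_aeval_eq_zero_of_isCoprime this hX (by rwa [aeval_shiftPoly])
  · exact not_aeval_eq_zero_of_isCoprime (hb.2 k hk0) hX (by rwa [aeval_shiftPoly])

/-- Zero is the only residual form of zero. -/
theorem residualForm_eq_zero_of_difference_eq [CharZero F] (hv : v ≠ 0)
    (huv : ∀ i : ℤ, IsCoprime u (shiftPoly i v)) (hb : IsShiftFree b)
    (hbK : IsStronglyPrime u v b) {a q : F[X]} (ha : a.degree < b.degree)
    (hq : q ∈ standardComplement u v) {w : RatFunc F}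
    (h : frac u v * shift w - w = frac a b + frac q v) : frac a b + frac q v = 0 := by
  have hsum := frac_add_frac a q hb.1 hv
  have hw := denom_eq_one_of_difference_eq hv huv hb hbK (h.trans hsum)
  have hbv : IsCoprime b v := by simpa using (hbK.2 0).2
  rw [hsum, ← frac_num_denom w, hw, frac_mul_shift_frac_sub_frac hv one_ne_zero,
    frac_eq_frac_iff (by simpa using hv) (mul_ne_zero hb.1 hv)] at h
  have key : phi u v w.num * b = a * v + b * q := by
    rw [phi_apply]
    simp only [shiftPoly_one, mul_one] at h
    exact mul_right_cancel₀ hv (by linear_combination h)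
  -- By `key`, `b` divides `a v` and hence `a`, so `a = 0` by degree; what remains is `q = φ_K(w)`,
  -- which lies in `W_K ∩ im(φ_K) = 0`.
  have hba : b ∣ a := hbv.dvd_of_dvd_mul_right
    ⟨phi u v w.num - q, by linear_combination -key⟩
  have ha0 : a = 0 := eq_zero_of_dvd_of_degree_lt hba ha
  have hq0 : q = 0 := by
    refine eq_zero_of_mem_standardComplement_of_mem_range hq ⟨w.num, ?_⟩
    rw [ha0] at key
    exact mul_left_cancel₀ hb.1 (by linear_combination key)
  simp [ha0, hq0, frac]

end Uniqueness

/-! ### Hypergeometric terms -/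

section TermLemmas

variable {D : Type*} [Ring D] {ι : RatFunc F →+* D} {σ : D →+* D}

/-- `D` may have zero divisors, but nonzero rational functions are units in it; this is what makes
`H` cancellable. -/
theorem eq_zero_of_map_mul_eq_zero {x : RatFunc F} {H : D} (hH : H ≠ 0) (h : ι x * H = 0) :
    x = 0 := by
  by_contra hx
  apply hH
  calc H = ι (x⁻¹ * x) * H := by rw [inv_mul_cancel₀ hx, map_one, one_mul]
    _ = ι x⁻¹ * (ι x * H) := by rw [map_mul, mul_assoc]
    _ = 0 := by rw [h, mul_zero]

theorem map_mul_left_injective {x y : RatFunc F} {H : D} (hH : H ≠ 0)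
    (h : ι x * H = ι y * H) : x = y :=
  sub_eq_zero.1 (eq_zero_of_map_mul_eq_zero (ι := ι) hH (by rw [map_sub, sub_mul, h, sub_self]))

/-- Writing the shift quotient of `T` as `K σ(S) / S` with `K` shift-reduced, `H = S⁻¹ T` has shift
quotient `K`. -/
theorem exists_isMultDecomp (hσ : ∀ R : RatFunc F, σ (ι R) = ι (shift R)) {T : D}
    (hT : IsHypergeometric ι σ T) (h0 : σ T ≠ 0) :
    ∃ (S : RatFunc F) (H : D) (K : RatFunc F) (u v : F[X]), IsMultDecomp ι σ T S H K u v := by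
  obtain ⟨hT0, R, hR⟩ := hT
  have hR0 : R ≠ 0 := by
    rintro rfl
    exact h0 (by rw [hR, map_zero, zero_mul])
  obtain ⟨K, S, hK, hS, hKS⟩ := exists_isShiftReduced_mul R hR0
  have hSS : ι S * (ι S⁻¹ * T) = T := by
    rw [← mul_assoc, ← map_mul, mul_inv_cancel₀ hS, map_one, one_mul]
  refine ⟨S, ι S⁻¹ * T, K, K.num, K.denom, hSS.symm, fun h => ?_, ?_, hK,
    K.isCoprime_num_denom, K.denom_ne_zero, (frac_num_denom K).symm⟩
  · rw [h, mul_zero] at hSS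
    exact hT0 hSS.symm
  · rw [map_mul, hσ, hR, ← mul_assoc, ← mul_assoc, ← map_mul, ← map_mul, map_inv₀, hKS]
    congr 2
    have := shift_ne_zero hS
    field_simp

/-! ### Translation between terms `w H` and rational functions `w`. -/

namespace IsMultDecomp

variable {T H : D} {S K : RatFunc F} {u v : F[X]}

theorem numerator_ne_zero (h : IsMultDecomp ι σ T S H K u v) : u ≠ 0 := by
  rintro rfl
  exact h.shiftReduced.1 (by simp [h.kernel_eq, frac])

theorem isCoprime_shiftPoly (h : IsMultDecomp ι σ T S H K u v) (i : ℤ) :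
    IsCoprime u (shiftPoly i v) :=
  h.shiftReduced.isCoprime_shiftPoly h.coprime h.denom_ne_zero h.kernel_eq i

theorem map_mul_eq (h : IsMultDecomp ι σ T S H K u v)
    (hσ : ∀ R : RatFunc F, σ (ι R) = ι (shift R)) (w : RatFunc F) :
    σ (ι w * H) = ι (K * shift w) * H := by
  rw [map_mul, hσ, h.quotient, ← mul_assoc, ← map_mul, mul_comm]

theorem difference_eq (h : IsMultDecomp ι σ T S H K u v)
    (hσ : ∀ R : RatFunc F, σ (ι R) = ι (shift R)) (w : RatFunc F) :
    σ (ι w * H) - ι w * H = ι (K * shift w - w) * H := by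
  rw [h.map_mul_eq hσ, ← sub_mul, ← map_sub]

/-- The kernel of an irrational term is not of the form `σ_y(r) / r`. -/
theorem kernel_ne (h : IsMultDecomp ι σ T S H K u v)
    (hσ : ∀ R : RatFunc F, σ (ι R) = ι (shift R)) (hirr : ¬ IsRationalTerm ι σ T)
    (r : RatFunc F) (hr : r ≠ 0) : K ≠ shift r / r := by
  intro hK
  -- If `H` has shift quotient `σ(r) / r`, then `r⁻¹ H` is a constant.
  refine hirr ⟨S * r, ι r⁻¹ * H, ?_, ?_⟩
  · rw [h.map_mul_eq hσ, hK, map_inv₀]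
    congr 2
    have := shift_ne_zero hr
    field_simp
  · rw [h.eq_mul, ← mul_assoc, ← map_mul, mul_assoc, mul_inv_cancel₀ hr, mul_one]

/-- A term is summable if and only if its shell is of the form `K σ_y(w) - w`. -/
theorem isSummable_iff (h : IsMultDecomp ι σ T S H K u v)
    (hσ : ∀ R : RatFunc F, σ (ι R) = ι (shift R)) (hT : T ≠ 0) :
    IsSummable ι σ T ↔ ∃ w : RatFunc F, S = K * shift w - w := by
  constructor
  · rintro ⟨G, ⟨-, R, hR⟩, hG⟩
    -- Hence `G` is a rational multiple of `T`, and so of `H`; no antiderivative outside `F(y) H`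
    -- has to be considered.
    have hTG : T = ι (R - 1) * G := by rw [hG, hR, map_sub, sub_mul, map_one, one_mul]
    have hR1 : R - 1 ≠ 0 := by
      intro h0
      exact hT (by rw [hTG, h0, map_zero, zero_mul])
    have hGH : G = ι ((R - 1)⁻¹ * S) * H := by
      rw [map_mul, mul_assoc, ← h.eq_mul, hTG, ← mul_assoc, ← map_mul, inv_mul_cancel₀ hR1,
        map_one, one_mul]
    refine ⟨(R - 1)⁻¹ * S, map_mul_left_injective (ι := ι) h.ne_zero ?_⟩
    rw [← h.eq_mul, hG, ← h.difference_eq hσ, ← hGH]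
  · rintro ⟨w, hw⟩
    have hTw : T = σ (ι w * H) - ι w * H := by rw [h.difference_eq hσ, ← hw, h.eq_mul]
    have hw0 : w ≠ 0 := by
      rintro rfl
      exact hT (by simpa using hTw)
    refine ⟨ι w * H, ⟨fun h0 => hw0 (eq_zero_of_map_mul_eq_zero h.ne_zero h0),
      K * shift w / w, ?_⟩, hTw⟩
    rw [h.map_mul_eq hσ, ← mul_assoc, ← map_mul, div_mul_cancel₀ _ hw0]

end IsMultDecomp

/-- The two parts of the output of the reduction decompose the shell. -/
theorem IsShellReduction.eq_add {u v : F[X]} (hu : u ≠ 0) (hv : v ≠ 0) {S g : RatFunc F}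
    {s b t : F[X]} (hs : IsShellReduction (frac u v) u v S g s b t) {h q : F[X]}
    (hq : q = v * (s / b) + t - phi u v h) :
    S - (frac (s % b) b + frac q v) =
      frac u v * shift (g + algebraMap F[X] (RatFunc F) h) -
        (g + algebraMap F[X] (RatFunc F) h) := by
  obtain ⟨S₁, w, p₁, p₂, ⟨hb, -, hS⟩, hw, hg, ht⟩ := hs
  have hu0 := algebraMap_ratFunc_ne_zero hu
  have hv0 := algebraMap_ratFunc_ne_zero hv
  have hu1 := algebraMap_ratFunc_ne_zero (shiftPoly_ne_zero (-1) hu)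
  have hb0 := algebraMap_ratFunc_ne_zero hb.1
  have hsb : algebraMap F[X] (RatFunc F) s = algebraMap F[X] (RatFunc F) b *
      algebraMap F[X] (RatFunc F) (s / b) + algebraMap F[X] (RatFunc F) (s % b) := by
    rw [← map_mul, ← map_add, EuclideanDomain.div_add_mod]
  -- Two cancellations drive the identity: `K σ(p₁ / σ⁻¹(u)) = σ(p₁) / v`, which produces `t`, and
  -- `φ_K(h) / v = K σ(h) - h`.
  rw [hS, hw, hg, hq, ht, phi_apply, map_add, map_sub, shift_frac, shift_algebraMap,
    shiftPoly_shiftPoly, add_neg_cancel, shiftPoly_zero]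
  simp only [frac, map_add, map_sub, map_mul, hsb]
  field_simp
  ring

end TermLemmas

end

end HypergeometricReduction

/-- Total correctness of the modified Abramov–Petkovšek reduction, step by step: no step can get
stuck, whatever the results of the earlier steps are, and every output is correct. -/
theorem mainTheorem1 {F : Type*} [Field F] [CharZero F] {D : Type*} [Ring D]
    (ι : RatFunc F →+* D) (σ : D →+* D)
    (hσ : ∀ R : RatFunc F, σ (ι R) = ι (HypergeometricReduction.shift R))
    (T : D) (hT : HypergeometricReduction.IsHypergeometric ι σ T)
    (hirr : ¬ HypergeometricReduction.IsRationalTerm ι σ T) :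
    -- step 1: a kernel and a shell exist (unless the shift quotient of `T` is zero)
    (σ T ≠ 0 → ∃ (S : RatFunc F) (H : D) (K : RatFunc F) (u v : F[X]),
      HypergeometricReduction.IsMultDecomp ι σ T S H K u v) ∧
    ∀ (S : RatFunc F) (H : D) (K : RatFunc F) (u v : F[X]),
      HypergeometricReduction.IsMultDecomp ι σ T S H K u v →
      -- step 2: shell reduction
      (∃ (g : RatFunc F) (s b t : F[X]),
        HypergeometricReduction.IsShellReduction K u v S g s b t) ∧
      (∃ P : ℕ → F[X], HypergeometricReduction.IsEchelonSequence u v P) ∧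
      ∀ (g : RatFunc F) (s b t : F[X]) (P : ℕ → F[X]),
        HypergeometricReduction.IsShellReduction K u v S g s b t →
        HypergeometricReduction.IsEchelonSequence u v P →
        -- steps 3 and 4: polynomial reduction of `v p + t`, where `p` is the quotient of `s` by `b`
        (∃ h q : F[X],
          HypergeometricReduction.IsPolynomialReduction u v P (v * (s / b) + t) h q) ∧
        ∀ h q : F[X],
          HypergeometricReduction.IsPolynomialReduction u v P (v * (s / b) + t) h q →
          -- step 5: the output `f`, `r`, where `a = s % b` is the remainder of `s` by `b`
          ∀ f r : RatFunc F,
            f = g + algebraMap F[X] (RatFunc F) h →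
            r = HypergeometricReduction.frac (s % b) b + HypergeometricReduction.frac q v →
            -- correctness of the output
            HypergeometricReduction.IsResidualForm K u v S r ∧
            T = (σ (ι f * H) - ι f * H) + ι r * H ∧
            (HypergeometricReduction.IsSummable ι σ T ↔ r = 0) := by
  refine ⟨fun h0 => HypergeometricReduction.exists_isMultDecomp hσ hT h0, ?_⟩
  intro S H K u v hd
  have hu := hd.numerator_ne_zero
  have hv := hd.denom_ne_zero
  have huv := hd.isCoprime_shiftPoly
  have hne := hd.kernel_ne hσ hirr
  have hsum := hd.isSummable_iff hσ hT.1
  have hdiff := hd.difference_eq hσ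
  have hTS := hd.eq_mul
  obtain rfl : K = HypergeometricReduction.frac u v := hd.kernel_eq
  refine ⟨HypergeometricReduction.exists_isShellReduction hu hv huv S,
    HypergeometricReduction.exists_isEchelonSequence
      (HypergeometricReduction.phi_injective hv hne), ?_⟩
  intro g s b t P hs hP
  refine ⟨hP.exists_isPolynomialReduction _, ?_⟩
  rintro h q hq f r rfl rfl
  have hw := hs.eq_add hu hv hq.eq_sub
  obtain ⟨hb, hbK⟩ : HypergeometricReduction.IsShiftFree b ∧
      HypergeometricReduction.IsStronglyPrime u v b := by
    obtain ⟨_, _, _, _, ⟨hb, hbK, -⟩, -⟩ := hs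
    exact ⟨hb, hbK⟩
  have hdeg : (s % b).degree < b.degree := EuclideanDomain.mod_lt s hb.1
  have hqW := hq.mem_standardComplement
  refine ⟨⟨⟨_, hw⟩, s % b, b, q, rfl, hdeg, hb, hbK, hqW⟩, ?_, ?_⟩
  · rw [hdiff, ← hw, ← add_mul, ← map_add, sub_add_cancel, hTS]
  · rw [hsum]
    constructor
    · rintro ⟨w, hS⟩
      -- Subtracting `S - r = K σ(f) - f` from `S = K σ(w) - w` shows that `r` itself lies in `V_K`,
      -- with witness `w - f`.
      refine HypergeometricReduction.residualForm_eq_zero_of_difference_eq hv huv hb hbK hdeg hqW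
        (w := w - (g + algebraMap F[X] (RatFunc F) h)) ?_
      rw [map_sub]
      linear_combination hw - hS
    · intro hr
      rw [hr, sub_zero] at hw
      exact ⟨_, hw⟩
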